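/- Let $\mathbb{A}=(a_{ij})_{i,j\in I}$ be a symmetrizable generalized Cartan matrix indexed by a finite set $I$ and let $(I,\mathbb{A},\Lambda,(c_i)_{i\in I},(h_i)_{i\in I})$ be a free and cofree Kac-Moody root datum: $\Lambda$ is a free $\mathbb{Z}$-module of finite rank, $(c_i)_{i\in I}\subset\Lambda$ and $(h_i)_{i\in I}\subset\Lambda^\vee=\operatorname{Hom}(\Lambda,\mathbb{Z})$ are linearly independent families, and $\langle c_j,h_i\rangle=a_{ij}$ for all $i,j\in I$. Put $\mathfrak{a}:=\Lambda^\vee\otimes_{\mathbb{Z}}\mathbb{R}$, let $\alpha_i\in\mathfrak{a}^*$ be the functional defined by $c_i$, and let $\alpha_i^\vee:=h_i\in\mathfrak{a}$. Let $W$ be the group generated by $S=\{s_i\mid i\in I\}$ subject to the relations $(s_is_j)^{m_{ij}}=1$, where $m_{ii}=1$ and, for $i\neq j$, $m_{ij}=2,3,4,6$ or $\infty$ (no relation) according to whether $a_{ij}a_{ji}=0,1,2,3$ or $\geq 4$. It acts linearly on $\mathfrak{a}$ by $s_i(x)=x-\langle\alpha_i,x\rangle\alpha_i^\vee$. For $J\subset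 I$ let $W_J:=\langle s_j\mid j\in J\rangle$. The left cosets $wW_J\subset W$ with $w\in W$ and $J\subset I$ are called standard cosets, and $\Sigma^*(W,S)$ denotes the set of all standard cosets (as subsets of $W$), ordered by inclusion. A face of a convex set $P$ is a non-empty convex subset $F\subset P$ such that $[p_1,p_2]\subset F$ whenever $p_1,p_2\in P$ and the open segment $(p_1,p_2)$ meets $F$. The dimension of a face is the dimension of its affine span. Let $h\in C:=\{x\in\mathfrak{a}\mid\langle\alpha_i,x\rangle>0\text{ for all }i\in I\}$, and put $\Xi_h:=\operatorname{conv}(W\cdot h)$ and $F_J:=\operatorname{conv}(W_J\cdot h)$ for $J\subset I$. Then for all $w\in W$ and $J\subset I$, the set $w(F_J)=\operatorname{conv}(wW_J\cdot h)$ is a face of $\Xi_h$ of dimension $|J|$. Conversely, for every face $F$ of $\Xi_h$ there is a unique standard coset $X$ such that $F=\operatorname{conv}(X\cdot h)$. Hence the map $X\mapsto\operatorname{conv}(X\cdot h)$ is a bijection from the set of standard cosets of $(W,S)$ onto the set of faces of $\Xi_h$, and it is an isomorphism of posets from $\Sigma^*(W,S)$ onto the poset of faces of $\Xi_h$ ordered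 by inclusion. -/

import Mathlib

open scoped TensorProduct Pointwise

/-- A generalized Cartan matrix indexed by `I`. -/
structure IsGeneralizedCartanMatrix {I : Type*} (A : Matrix I I ℤ) : Prop where
  diag : ∀ i, A i i = 2
  offDiag_nonpos : ∀ i j, i ≠ j → A i j ≤ 0
  eq_zero_iff : ∀ i j, A i j = 0 ↔ A j i = 0

/-- `A` is symmetrizable: `A = D * B` with `D` diagonal and `B` symmetric. -/
def IsSymmetrizable {I : Type*} [Fintype I] [DecidableEq I] (A : Matrix I I ℤ) : Prop :=
  ∃ (d : I → ℝ) (B : Matrix I I ℝ), B.IsSymm ∧ A.map (Int.cast : ℤ → ℝ) = Matrix.diagonal d * B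

/-- A Kac-Moody root datum `(I, A, Λ, (c i), (h i))`, where `Λ` is a free `ℤ`-module of finite
rank, `c i ∈ Λ`, `h i ∈ Λ^∨` and `⟨c j, h i⟩ = A i j`. -/
structure KacMoodyRootDatum (I Λ : Type*) [AddCommGroup Λ] [Module.Free ℤ Λ]
    [Module.Finite ℤ Λ] where
  A : Matrix I I ℤ
  isGCM : IsGeneralizedCartanMatrix A
  c : I → Λ
  h : I → Module.Dual ℤ Λ
  pairing : ∀ i j, h i (c j) = A i j

/-- A face of a convex set `P`: a non-empty convex subset `F ⊆ P` such that any segment with end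
points in `P` whose relative interior meets `F` lies in `F` (as `F` is convex, it suffices that
the end points lie in `F`, which is what `IsExtreme` says). -/
structure IsConvexFace {V : Type*} [AddCommGroup V] [Module ℝ V] (P F : Set V) : Prop where
  nonempty : F.Nonempty
  convex : Convex ℝ F
  isExtreme : IsExtreme ℝ P F

/-- The face poset of `P`, ordered by inclusion. -/
abbrev FacePoset {V : Type*} [AddCommGroup V] [Module ℝ V] (P : Set V) : Type _ :=
  {F : Set V // IsConvexFace P F}

/-- The dimension of a set: the dimension of its affine span. -/
noncomputable def affineDim {V : Type*} [AddCommGroup V] [Module ℝ V] (F : Set V) : ℕ :=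
  Module.finrank ℝ (affineSpan ℝ F).direction

namespace KacMoodyRootDatum

variable {I Λ : Type*} [AddCommGroup Λ] [Module.Free ℤ Λ] [Module.Finite ℤ Λ]
  (D : KacMoodyRootDatum I Λ)

/-- The root datum is free. -/
def IsFree : Prop := LinearIndependent ℤ D.c

/-- The root datum is cofree. -/
def IsCofree : Prop := LinearIndependent ℤ D.h

/-- The real Cartan subalgebra `𝔞 = Λ^∨ ⊗ ℝ`. -/
abbrev Cartan (_D : KacMoodyRootDatum I Λ) : Type _ := ℝ ⊗[ℤ] Module.Dual ℤ Λ

/-- The simple root `α i`, i.e. `c i` viewed as a linear functional on `𝔞`. -/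
noncomputable def root (i : I) : Module.Dual ℝ D.Cartan :=
  Module.Dual.baseChange ℝ (Module.Dual.eval ℤ Λ (D.c i))

/-- The simple coroot `α i ^∨`, i.e. `h i` viewed as an element of `𝔞`. -/
noncomputable def coroot (i : I) : D.Cartan := (1 : ℝ) ⊗ₜ[ℤ] D.h i

theorem root_coroot (i j : I) : D.root j (D.coroot i) = (D.A i j : ℝ) := by
  simp [root, coroot, D.pairing]

theorem root_coroot_self (i : I) : D.root i (D.coroot i) = 2 := by
  simp [root_coroot, D.isGCM.diag]

/-- The open fundamental chamber `C`. -/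
def openChamber : Set D.Cartan := {x | ∀ i, 0 < D.root i x}

/-- The order of `s i * s j` (for `i ≠ j`) as a function of `a i j * a j i`; the value `0`
stands for `∞`. -/
def orderOfProduct (p : ℤ) : ℕ :=
  if p = 0 then 2 else if p = 1 then 3 else if p = 2 then 4 else if p = 3 then 6 else 0

theorem orderOfProduct_ne_one (p : ℤ) : orderOfProduct p ≠ 1 := by
  unfold orderOfProduct
  split_ifs <;> decide

variable [DecidableEq I]

/-- The Coxeter matrix of the Weyl group. -/
def coxeterMatrix : CoxeterMatrix I where
  M := Matrix.of fun i j => if i = j then 1 else orderOfProduct (D.A i j * D.A j i)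
  isSymm := by
    ext i j
    simp [Matrix.transpose_apply, eq_comm, mul_comm]
  diagonal i := by simp
  off_diagonal i j hij := by simpa [hij] using orderOfProduct_ne_one _

/-- The Weyl group `W`, defined by its Coxeter presentation. -/
abbrev Weyl : Type _ := D.coxeterMatrix.Group

/-- The reflection `x ↦ x - ⟨α i, x⟩ α i ^∨` of `𝔞`. -/
noncomputable def simpleReflection (i : I) : D.Cartan ≃ₗ[ℝ] D.Cartan :=
  Module.reflection (D.root_coroot_self i)

theorem simpleReflection_isLiftable : D.coxeterMatrix.IsLiftable D.simpleReflection := by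
  intro i j
  ext1 z
  by_cases hij : i = j
  · subst hij
    have h1 : D.coxeterMatrix i i = 1 := D.coxeterMatrix.diagonal i
    rw [h1, pow_one]
    exact Module.involutive_reflection (D.root_coroot_self i) z
  · have hm : D.coxeterMatrix i j = orderOfProduct (D.A i j * D.A j i) := by
      simp [coxeterMatrix, hij]
    rw [hm]
    simp only [simpleReflection]
    set a : ℤ := D.A i j with ha
    set b : ℤ := D.A j i with hb
    have hba : D.root i (D.coroot j) = (b : ℝ) := D.root_coroot j i
    have hab : D.root j (D.coroot i) = (a : ℝ) := D.root_coroot i j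
    unfold orderOfProduct
    have key : ∀ p : ℤ, a * b = p → D.root i (D.coroot j) * D.root j (D.coroot i) = (p : ℝ) := by
      intro p hp
      rw [hba, hab, ← hp, Int.cast_mul, mul_comm]
    split_ifs with h0 h1 h2 h3
    · have ha0 : a = 0 := by
        rcases mul_eq_zero.mp h0 with h | h
        · exact h
        · exact (D.isGCM.eq_zero_iff i j).mpr h
      have hb0 : b = 0 := (D.isGCM.eq_zero_iff i j).mp ha0
      simp [pow_two, Module.reflection_apply, hba, hab, ha0, hb0, D.root_coroot_self]
      module
    · rw [Module.reflection_mul_reflection_pow_apply _ _ 3 z (-1)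
        (by rw [key _ h1]; norm_num)]
      norm_num
    · rw [Module.reflection_mul_reflection_pow_apply _ _ 4 z 0
        (by rw [key _ h2]; norm_num)]
      norm_num
    · rw [Module.reflection_mul_reflection_pow_apply _ _ 6 z 1
        (by rw [key _ h3]; norm_num)]
      norm_num [Polynomial.Chebyshev.S_two]
    · simp

/-- The linear action of `W` on `𝔞`, in which the generator `s i` acts by `simpleReflection i`. -/
noncomputable def action : D.Weyl →* (D.Cartan ≃ₗ[ℝ] D.Cartan) :=
  D.coxeterMatrix.toCoxeterSystem.lift ⟨D.simpleReflection, D.simpleReflection_isLiftable⟩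

theorem action_simple (i : I) : D.action (D.coxeterMatrix.simple i) = D.simpleReflection i :=
  D.coxeterMatrix.toCoxeterSystem.lift_apply_simple D.simpleReflection_isLiftable i

/-- The standard subgroup `W_J`, generated by the `s j` with `j ∈ J`. -/
def standardSubgroup (J : Finset I) : Subgroup D.Weyl :=
  Subgroup.closure (D.coxeterMatrix.simple '' (J : Set I))

/-- The poset `Σ*(W, S)` of all standard cosets `w W_J` (as subsets of `W`), ordered by
inclusion. -/
abbrev StandardCosets : Type _ :=
  {X : Set D.Weyl // ∃ (w : D.Weyl) (J : Finset I), X = w • (D.standardSubgroup J : Set D.Weyl)}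

/-- `conv(X · x)` for a subset `X` of `W` and a point `x` of `𝔞`. -/
def hull (X : Set D.Weyl) (x : D.Cartan) : Set D.Cartan :=
  convexHull ℝ ((fun u => D.action u x) '' X)

/-- The convex hull `Ξ_x` of the full orbit `W · x`. -/
def Xi (x : D.Cartan) : Set D.Cartan := D.hull Set.univ x

end KacMoodyRootDatum

/-!
If `ℓ(w s i) > ℓ(w)`, then `w` maps the coroot `α i ^∨` into the cone `Q₊` generated by the simple
coroots: splitting off from `w` its part in a dihedral group `⟨s i, s t⟩` reduces this to rank two.
Adding up along a reduced word, the whole orbit of a point `x` of the open chamber, and with it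
`Ξ_x`, lies in `x - Q₊`.

By cofreeness `Q₊` is simplicial, so every set `J` of indices cuts out the face
`{y ∈ Ξ_x | x - y ∈ span (α j ^∨)_{j ∈ J}}` of `Ξ_x`, and the points of the orbit on it are exactly
those of `W_J · x`. Conversely, each orbit point `y` satisfies `y - x = ∑ c i (s i x - x)` with
`c i ≥ 0`, so a face through `x` is determined by the points `s i x` it contains. Every face
contains an orbit point, which the action of `W` moves to `x`.
-/

section Extreme

variable {𝕜 V : Type*} [Semiring 𝕜] [PartialOrder 𝕜] [IsOrderedRing 𝕜] [AddCommGroup V]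
  [Module 𝕜 V]

theorem subset_convexHull_inter_of_isExtreme {S F : Set V}
    (hF : IsExtreme 𝕜 (convexHull 𝕜 S) F) : F ⊆ convexHull 𝕜 (S ∩ F) := by
  suffices h : convexHull 𝕜 S ⊆ {y ∈ convexHull 𝕜 S | y ∈ F → y ∈ convexHull 𝕜 (S ∩ F)} from
    fun y hy => (h (hF.subset hy)).2 hy
  refine convexHull_min
    (fun y hy => ⟨subset_convexHull 𝕜 S hy, fun hyF => subset_convexHull 𝕜 _ ⟨hy, hyF⟩⟩) ?_
  rw [convex_iff_openSegment_subset]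
  rintro p ⟨hp, hpF⟩ q ⟨hq, hqF⟩ y hy
  refine ⟨(convex_convexHull 𝕜 S).openSegment_subset hp hq hy, fun hyF => ?_⟩
  exact (convex_convexHull 𝕜 _).openSegment_subset
    (hpF (hF.left_mem_of_mem_openSegment hp hq hyF hy))
    (hqF (hF.right_mem_of_mem_openSegment hp hq hyF hy)) hy

theorem sub_smul_add_smul_eq {R M : Type*} [Semiring R] [AddCommGroup M] [Module R M] {a b : R}
    (hab : a + b = 1) (x p q : M) : x - (a • p + b • q) = a • (x - p) + b • (x - q) := by
  rw [smul_sub, smul_sub, sub_add_sub_comm, ← add_smul, hab, one_smul]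

theorem isExtreme_sep_sub_mem {C G : PointedCone 𝕜 V} (hG : G.IsFaceOf C) {P : Set V} {x : V}
    (hP : ∀ y ∈ P, x - y ∈ C) : IsExtreme 𝕜 P {y ∈ P | x - y ∈ G} := by
  refine ⟨Set.sep_subset _ _, ?_⟩
  rintro p hp q hq _ ⟨-, hz⟩ ⟨a, b, ha, hb, hab, rfl⟩
  rw [sub_smul_add_smul_eq hab] at hz
  exact ⟨hp, hG.mem_of_smul_add_smul_mem_left (hP p hp) (hP q hq) ha hb hz⟩

theorem convex_setOf_sub_mem (C : PointedCone 𝕜 V) (x : V) : Convex 𝕜 {y | x - y ∈ C} := by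
  intro p hp q hq a b ha hb hab
  rw [Set.mem_ofPred_eq, sub_smul_add_smul_eq hab]
  exact C.convex hp hq ha hb hab

end Extreme

theorem mem_hull_range_iff_exists_linearCombination {𝕜 V ι : Type*} [Ring 𝕜] [PartialOrder 𝕜]
    [IsOrderedRing 𝕜] [AddCommGroup V] [Module 𝕜 V] {e : ι → V} {v : V} :
    v ∈ PointedCone.hull 𝕜 (Set.range e) ↔
      ∃ c : ι →₀ 𝕜, 0 ≤ c ∧ Finsupp.linearCombination 𝕜 e c = v := by
  constructor
  · intro hv
    induction hv using Submodule.span_induction with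
    | mem v hv =>
      obtain ⟨i, rfl⟩ := hv
      exact ⟨Finsupp.single i 1, by simp, by simp⟩
    | zero => exact ⟨0, le_rfl, map_zero _⟩
    | add u v _ _ hu hv =>
      obtain ⟨c, hc, rfl⟩ := hu
      obtain ⟨d, hd, rfl⟩ := hv
      exact ⟨c + d, add_nonneg hc hd, map_add _ _ _⟩
    | smul r v _ hv =>
      obtain ⟨c, hc, rfl⟩ := hv
      exact ⟨(r : 𝕜) • c, fun i => mul_nonneg r.2 (hc i), map_smul _ _ _⟩
  · rintro ⟨c, hc, rfl⟩
    exact sum_mem fun i _ =>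
      PointedCone.smul_mem _ (hc i) (PointedCone.subset_hull ⟨i, rfl⟩)

theorem linearCombination_mem_span_image_iff {R V ι : Type*} [Ring R] [AddCommGroup V] [Module R V]
    {e : ι → V} (he : LinearIndependent R e) {J : Set ι} {c : ι →₀ R} :
    Finsupp.linearCombination R e c ∈ Submodule.span R (e '' J) ↔ (c.support : Set ι) ⊆ J := by
  rw [Finsupp.mem_span_image_iff_linearCombination]
  constructor
  · rintro ⟨d, hd, hdc⟩
    obtain rfl := he.finsuppLinearCombination_injective hdc
    exact hd
  · exact fun hc => ⟨c, hc, rfl⟩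

theorem isFaceOf_hull_range_inf_span_image {𝕜 V ι : Type*} [Field 𝕜] [LinearOrder 𝕜]
    [IsStrictOrderedRing 𝕜] [AddCommGroup V] [Module 𝕜 V] {e : ι → V}
    (he : LinearIndependent 𝕜 e) (J : Set ι) :
    (PointedCone.hull 𝕜 (Set.range e) ⊓ Submodule.span 𝕜 (e '' J)).IsFaceOf
      (PointedCone.hull 𝕜 (Set.range e)) := by
  refine .of_mem_of_add_mem_left inf_le_left fun {u v} hu hv huv => ⟨hu, ?_⟩
  obtain ⟨c, hc, rfl⟩ := mem_hull_range_iff_exists_linearCombination.1 hu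
  obtain ⟨d, hd, rfl⟩ := mem_hull_range_iff_exists_linearCombination.1 hv
  have hcd := huv.2
  rw [← map_add] at hcd
  refine (linearCombination_mem_span_image_iff he).2 fun i hi => ?_
  refine (linearCombination_mem_span_image_iff he).1 hcd ?_
  have hci : c i ≠ 0 := by simpa using hi
  simpa using (add_pos_of_pos_of_nonneg ((hc i).lt_of_ne' hci) (hd i)).ne'

section Face

variable {V V' ι : Type*} [AddCommGroup V] [Module ℝ V] [AddCommGroup V'] [Module ℝ V']
  {P F : Set V}

theorem IsConvexFace.convexHull_inter {S : Set V} (hF : IsConvexFace (convexHull ℝ S) F) :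
    convexHull ℝ (S ∩ F) = F :=
  (convexHull_min Set.inter_subset_right hF.convex).antisymm
    (subset_convexHull_inter_of_isExtreme hF.isExtreme)

theorem IsConvexFace.image (hF : IsConvexFace P F) (f : V ≃ₗ[ℝ] V') :
    IsConvexFace (f '' P) (f '' F) where
  nonempty := hF.nonempty.image f
  convex := hF.convex.linear_image f.toLinearMap
  isExtreme := by
    refine ⟨Set.image_mono hF.isExtreme.subset, ?_⟩
    rintro _ ⟨p, hp, rfl⟩ _ ⟨q, hq, rfl⟩ _ ⟨z, hz, rfl⟩ ⟨a, b, ha, hb, hab, h⟩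
    refine ⟨p, hF.isExtreme.left_mem_of_mem_openSegment hp hq hz ⟨a, b, ha, hb, hab, ?_⟩, rfl⟩
    exact f.injective (by simpa using h)

theorem IsConvexFace.sum_mem_iff (hF : IsConvexFace P F) (hP : Convex ℝ P) {s : Finset ι}
    {w : ι → ℝ} {z : ι → V} (hw : ∀ i ∈ s, 0 < w i) (hw1 : ∑ i ∈ s, w i = 1)
    (hz : ∀ i ∈ s, z i ∈ P) : ∑ i ∈ s, w i • z i ∈ F ↔ ∀ i ∈ s, z i ∈ F := by
  classical
  refine ⟨fun h i hi => ?_, fun h => hF.convex.sum_mem (fun i hi => (hw i hi).le) hw1 h⟩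
  have hw_erase : ∀ j ∈ s.erase i, 0 < w j := fun j hj => hw j (Finset.mem_of_mem_erase hj)
  rw [← Finset.add_sum_erase s _ hi] at h hw1
  rcases (s.erase i).eq_empty_or_nonempty with hs | hs
  · simp_all
  have hpos : 0 < ∑ j ∈ s.erase i, w j := Finset.sum_pos hw_erase hs
  have hcenter : (s.erase i).centerMass w z ∈ P :=
    hP.centerMass_mem (fun j hj => (hw_erase j hj).le) hpos
      fun j hj => hz j (Finset.mem_of_mem_erase hj)
  refine hF.isExtreme.left_mem_of_mem_openSegment (hz i hi) hcenter h
    ⟨w i, ∑ j ∈ s.erase i, w j, hw i hi, hpos, hw1, ?_⟩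
  rw [Finset.centerMass, smul_inv_smul₀ hpos.ne']

theorem IsConvexFace.add_smul_mem (hF : IsConvexFace P F) {x v : V} {r : ℝ} (hx : x ∈ F)
    (hv : x + v ∈ F) (hr : 0 < r) (hrv : x + r • v ∈ P) : x + r • v ∈ F := by
  rcases le_or_gt r 1 with hr1 | hr1
  · exact hF.convex.add_smul_mem hx hv ⟨hr.le, hr1⟩
  · have hinv : r⁻¹ < 1 := inv_lt_one_of_one_lt₀ hr1
    refine hF.isExtreme.right_mem_of_mem_openSegment (hF.isExtreme.subset hx) hrv hv
      ⟨1 - r⁻¹, r⁻¹, sub_pos.2 hinv, inv_pos.2 hr, sub_add_cancel _ _, ?_⟩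
    rw [smul_add, inv_smul_smul₀ hr.ne']
    module

theorem IsConvexFace.mem_iff_of_sub_eq_sum (hF : IsConvexFace P F) (hP : Convex ℝ P) {x y : V}
    (hx : x ∈ F) (hy : y ∈ P) {s : Finset ι} {c : ι → ℝ} {z : ι → V} (hc : ∀ i ∈ s, 0 < c i)
    (hz : ∀ i ∈ s, z i ∈ P) (hyz : y - x = ∑ i ∈ s, c i • (z i - x)) :
    y ∈ F ↔ ∀ i ∈ s, z i ∈ F := by
  rcases s.eq_empty_or_nonempty with rfl | hs
  · have : y = x := by simpa [sub_eq_zero] using hyz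
    simpa [this] using hx
  -- `y` and the weighted mean of the `z i` lie on a ray from `x`, so `F` contains both or neither.
  set N : ℝ := ∑ i ∈ s, c i
  have hN : 0 < N := Finset.sum_pos hc hs
  have hw : ∀ i ∈ s, 0 < N⁻¹ * c i := fun i hi => mul_pos (inv_pos.2 hN) (hc i hi)
  have hw1 : ∑ i ∈ s, N⁻¹ * c i = 1 := by rw [← Finset.mul_sum, inv_mul_cancel₀ hN.ne']
  have hmean : x + N⁻¹ • (y - x) = ∑ i ∈ s, (N⁻¹ * c i) • z i := by
    rw [hyz, Finset.smul_sum]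
    simp only [smul_smul, smul_sub, Finset.sum_sub_distrib]
    rw [← Finset.sum_smul, hw1, one_smul, add_sub_cancel]
  have hmeanP : x + N⁻¹ • (y - x) ∈ P := by
    rw [hmean]
    exact hP.sum_mem (fun i hi => (hw i hi).le) hw1 hz
  rw [← hF.sum_mem_iff hP hw hw1 hz, ← hmean]
  have hcancel : x + N • N⁻¹ • (y - x) = y := by rw [smul_inv_smul₀ hN.ne', add_sub_cancel]
  constructor
  · intro h
    exact hF.add_smul_mem hx (by rwa [add_sub_cancel]) (inv_pos.2 hN) hmeanP
  · intro h
    simpa only [hcancel] using hF.add_smul_mem hx h hN (by rwa [hcancel])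

theorem affineDim_image (f : V ≃ₗ[ℝ] V') (F : Set V) : affineDim (f '' F) = affineDim F := by
  have hspan : vectorSpan ℝ (f '' F) = (vectorSpan ℝ F).map (f : V →ₗ[ℝ] V') :=
    ((f : V →ₗ[ℝ] V').toAffineMap.map_vectorSpan (s := F)).symm
  rw [affineDim, affineDim, direction_affineSpan, direction_affineSpan, hspan]
  exact LinearEquiv.finrank_map_eq f _

end Face

section Coxeter

variable {B W : Type*} [Group W] {M : CoxeterMatrix B} (cs : CoxeterSystem M W)

open CoxeterSystem (alternatingWord)

theorem induction_on_not_isRightDescent {p : W → Prop} (one : p 1)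
    (mul_simple : ∀ w i, ¬ cs.IsRightDescent w i → p w → p (w * cs.simple i)) (w : W) : p w := by
  induction hl : cs.length w using Nat.strong_induction_on generalizing w with
  | _ l ih =>
  subst hl
  by_cases hw : w = 1
  · rwa [hw]
  obtain ⟨i, hi⟩ := cs.exists_rightDescent_of_ne_one hw
  have h := mul_simple (w * cs.simple i) i
    (cs.isRightDescent_iff_not_isRightDescent_mul.1 hi) (ih _ hi _ rfl)
  rwa [cs.simple_mul_simple_cancel_right] at h

theorem length_mul_wordProd_alternatingWord_le (v : W) (i t : B) (k : ℕ) :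
    cs.length (v * cs.wordProd (alternatingWord i t k)) ≤ cs.length v + k := by
  have h := cs.length_wordProd_le (alternatingWord i t k)
  rw [CoxeterSystem.length_alternatingWord] at h
  exact (cs.length_mul_le _ _).trans (by gcongr)

/-- The braid relation rewrites an alternating word of length `M i t` ending in `t` as one ending
in `i`. -/
theorem isRightDescent_mul_wordProd_alternatingWord {v : W} {i t : B} (hM : M i t ≠ 0)
    (hlen : cs.length (v * cs.wordProd (alternatingWord i t (M i t))) = cs.length v + M i t) :
    cs.IsRightDescent (v * cs.wordProd (alternatingWord i t (M i t))) i := by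
  obtain ⟨k, hk⟩ := Nat.exists_eq_succ_of_ne_zero hM
  have hbraid : cs.wordProd (alternatingWord i t (M i t)) =
      cs.wordProd (alternatingWord i t k) * cs.simple i := by
    have h := cs.wordProd_braidWord_eq i t
    rwa [CoxeterSystem.braidWord, CoxeterSystem.braidWord, M.symmetric t i, hk,
      CoxeterSystem.alternatingWord_succ t i, cs.wordProd_concat, ← hk] at h
  rw [CoxeterSystem.IsRightDescent, hlen, hbraid, mul_assoc, cs.simple_mul_simple_cancel_right, hk]
  exact Nat.lt_succ_of_le (length_mul_wordProd_alternatingWord_le cs v i t k)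

/-- Here `v` is the shortest element of the coset `w ⟨s i, s t⟩`. -/
theorem exists_eq_mul_wordProd_alternatingWord {w : W} {i : B} (hi : ¬ cs.IsRightDescent w i)
    (t : B) :
    ∃ (v : W) (k : ℕ), w = v * cs.wordProd (alternatingWord i t k) ∧
      cs.length w = cs.length v + k ∧ ¬ cs.IsRightDescent v i ∧ ¬ cs.IsRightDescent v t ∧
      (M i t = 0 ∨ k < M i t) := by
  induction hl : cs.length w using Nat.strong_induction_on generalizing w i t with
  | _ l ih =>
  subst hl
  by_cases ht : cs.IsRightDescent w t
  · obtain ⟨v, k, hw, hlen, hvt, hvi, hk⟩ :=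
      ih _ ht (cs.isRightDescent_iff_not_isRightDescent_mul.1 ht) i rfl
    have hwv : w = v * cs.wordProd (alternatingWord i t (k + 1)) := by
      rw [CoxeterSystem.alternatingWord_succ, cs.wordProd_concat, ← mul_assoc, ← hw,
        cs.simple_mul_simple_cancel_right]
    have hlen' : cs.length w = cs.length v + (k + 1) := by
      rw [← cs.isRightDescent_iff.1 ht, hlen, add_assoc]
    refine ⟨v, k + 1, hwv, hlen', hvi, hvt, ?_⟩
    rw [M.symmetric t i] at hk
    refine hk.imp_right fun hk =>
      (show k + 1 ≤ M i t from hk).lt_of_ne fun (hkM : k + 1 = M i t) => hi ?_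
    rw [hwv, hkM] at hlen' ⊢
    exact isRightDescent_mul_wordProd_alternatingWord cs (by omega) hlen'
  · exact ⟨w, 0, by simp [alternatingWord], rfl, hi, ht, Nat.eq_zero_or_pos _⟩

end Coxeter

namespace KacMoodyRootDatum

open CoxeterSystem (alternatingWord)

variable {I Λ : Type*} [AddCommGroup Λ] [Module.Free ℤ Λ] [Module.Finite ℤ Λ]
  {D : KacMoodyRootDatum I Λ}

/-- The subspace of `𝔞` spanned by the simple coroots `α j ^∨` with `j ∈ J`, which is the direction
of the face `conv(W_J · x)`. -/
def corootSpan (D : KacMoodyRootDatum I Λ) (J : Finset I) : Submodule ℝ D.Cartan :=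
  Submodule.span ℝ (D.coroot '' J)

/-- The cone `Q₊` in `𝔞` generated by the simple coroots, which contains `x - Ξ_x` for `x` in the
open chamber. -/
def corootCone (D : KacMoodyRootDatum I Λ) : PointedCone ℝ D.Cartan :=
  PointedCone.hull ℝ (Set.range D.coroot)

theorem coroot_mem_corootSpan {J : Finset I} {j : I} (hj : j ∈ J) :
    D.coroot j ∈ D.corootSpan J :=
  Submodule.subset_span ⟨j, hj, rfl⟩

theorem coroot_mem_corootCone (i : I) : D.coroot i ∈ D.corootCone :=
  PointedCone.subset_hull ⟨i, rfl⟩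

theorem linearIndependent_coroot (hcofree : D.IsCofree) : LinearIndependent ℝ D.coroot :=
  Module.Flat.linearIndependent_one_tmul hcofree

theorem mem_of_coroot_mem_corootSpan (hcofree : D.IsCofree) {J : Finset I} {j : I}
    (hj : D.coroot j ∈ D.corootSpan J) : j ∈ J :=
  by_contra fun hjJ => (linearIndependent_coroot hcofree).notMem_span_image hjJ hj

theorem finrank_corootSpan (hcofree : D.IsCofree) (J : Finset I) :
    Module.finrank ℝ (D.corootSpan J) = J.card := by
  have hrange : Set.range (D.coroot ∘ ((↑) : J → I)) = D.coroot '' J := by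
    rw [Set.range_comp, Subtype.range_coe]
  have h := finrank_span_eq_card ((linearIndependent_coroot hcofree).comp ((↑) : J → I)
    Subtype.val_injective)
  rwa [hrange, Fintype.card_coe] at h

theorem neg_A_nonneg {i t : I} (hit : i ≠ t) : 0 ≤ -(D.A i t : ℝ) :=
  neg_nonneg.2 (Int.cast_nonpos.2 (D.isGCM.offDiag_nonpos i t hit))

theorem simpleReflection_apply (i : I) (v : D.Cartan) :
    D.simpleReflection i v = v - D.root i v • D.coroot i :=
  Module.reflection_apply _ _

theorem coxeterMatrix_apply_of_ne [DecidableEq I] {i j : I} (hij : i ≠ j) :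
    D.coxeterMatrix i j = orderOfProduct (D.A i j * D.A j i) :=
  if_neg hij

variable [DecidableEq I]

/-- The Weyl group with its simple reflections as a Coxeter system, which gives access to lengths
and descents. -/
abbrev coxeterSystem (D : KacMoodyRootDatum I Λ) : CoxeterSystem D.coxeterMatrix D.Weyl :=
  D.coxeterMatrix.toCoxeterSystem

theorem action_mul_apply (u w : D.Weyl) (v : D.Cartan) :
    D.action (u * w) v = D.action u (D.action w v) := by
  rw [map_mul, LinearEquiv.mul_apply]

theorem action_simple_apply (i : I) (v : D.Cartan) :
    D.action (D.coxeterSystem.simple i) v = v - D.root i v • D.coroot i := by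
  rw [CoxeterMatrix.toCoxeterSystem_simple, action_simple, simpleReflection_apply]

theorem sub_action_mul_simple (x : D.Cartan) (w : D.Weyl) (i : I) :
    x - D.action (w * D.coxeterSystem.simple i) x =
      (x - D.action w x) + D.root i x • D.action w (D.coroot i) := by
  rw [action_mul_apply, action_simple_apply, map_sub, map_smul]
  abel

theorem action_wordProd_alternatingWord_succ (i t : I) (k : ℕ) (v : D.Cartan) :
    D.action (D.coxeterSystem.wordProd (alternatingWord i t (k + 1))) v =
      D.action (D.coxeterSystem.wordProd (alternatingWord t i k))
        (v - D.root t v • D.coroot t) := by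
  rw [CoxeterSystem.alternatingWord_succ, CoxeterSystem.wordProd_concat, action_mul_apply,
    action_simple_apply]

/-- The image of the simple coroot `α i ^∨` under the alternating product `⋯ s i s t` of `k` simple
reflections: the rank two case of the action of a group element on a simple coroot. -/
noncomputable def dihedralCoroot (D : KacMoodyRootDatum I Λ) (i t : I) (k : ℕ) : D.Cartan :=
  D.action (D.coxeterSystem.wordProd (alternatingWord i t k)) (D.coroot i)

theorem dihedralCoroot_zero (i t : I) : D.dihedralCoroot i t 0 = D.coroot i := by
  simp [dihedralCoroot, alternatingWord]

theorem dihedralCoroot_one (i t : I) :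
    D.dihedralCoroot i t 1 = D.coroot i - (D.A i t : ℝ) • D.coroot t := by
  rw [dihedralCoroot, action_wordProd_alternatingWord_succ, root_coroot]
  simp [alternatingWord]

theorem dihedralCoroot_add_two (i t : I) (k : ℕ) :
    D.dihedralCoroot i t (k + 2) =
      -(D.A i t : ℝ) • D.dihedralCoroot t i (k + 1) - D.dihedralCoroot i t k := by
  have hi : D.coroot i - D.root i (D.coroot i) • D.coroot i = -D.coroot i := by
    rw [root_coroot_self]
    module
  rw [dihedralCoroot, action_wordProd_alternatingWord_succ, map_sub, map_smul,
    action_wordProd_alternatingWord_succ t i k (D.coroot i), hi, map_neg, root_coroot]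
  simp only [dihedralCoroot]
  module

theorem dihedralCoroot_two {i t : I} {q : ℝ} (hq : (D.A i t : ℝ) * D.A t i = q) :
    D.dihedralCoroot i t 2 = (q - 1) • D.coroot i + -(D.A i t : ℝ) • D.coroot t := by
  rw [dihedralCoroot_add_two, dihedralCoroot_one, dihedralCoroot_zero, ← hq]
  module

theorem dihedralCoroot_three {i t : I} {q : ℝ} (hq : (D.A i t : ℝ) * D.A t i = q) :
    D.dihedralCoroot i t 3 =
      (q - 1) • D.coroot i + (-(D.A i t : ℝ) * (q - 2)) • D.coroot t := by
  rw [dihedralCoroot_add_two, dihedralCoroot_two (mul_comm (D.A i t : ℝ) _ ▸ hq),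
    dihedralCoroot_one, ← hq]
  module

theorem dihedralCoroot_four {i t : I} {q : ℝ} (hq : (D.A i t : ℝ) * D.A t i = q) :
    D.dihedralCoroot i t 4 =
      (q ^ 2 - 3 * q + 1) • D.coroot i + (-(D.A i t : ℝ) * (q - 2)) • D.coroot t := by
  rw [dihedralCoroot_add_two, dihedralCoroot_three (mul_comm (D.A i t : ℝ) _ ▸ hq),
    dihedralCoroot_two hq, ← hq]
  module

theorem dihedralCoroot_five {i t : I} {q : ℝ} (hq : (D.A i t : ℝ) * D.A t i = q) :
    D.dihedralCoroot i t 5 =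
      (q ^ 2 - 3 * q + 1) • D.coroot i + (-(D.A i t : ℝ) * ((q - 1) * (q - 3))) • D.coroot t := by
  rw [dihedralCoroot_add_two, dihedralCoroot_four (mul_comm (D.A i t : ℝ) _ ▸ hq),
    dihedralCoroot_three hq, ← hq]
  module

variable {C : PointedCone ℝ D.Cartan}

theorem dihedralCoroot_mem_of_four_le {i t : I} (hit : i ≠ t) (hi : D.coroot i ∈ C)
    (ht : D.coroot t ∈ C) (hq : 4 ≤ (D.A i t : ℝ) * D.A t i) (k : ℕ) :
    D.dihedralCoroot i t k ∈ C := by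
  suffices h : D.dihedralCoroot i t k ∈ C ∧
      D.dihedralCoroot i t (k + 1) + ((D.A i t : ℝ) / 2) • D.dihedralCoroot t i k ∈ C from h.1
  -- With `a = -A i t`, `b = -A t i` and `u`, `v` the sequences of `(i, t)` and `(t, i)`,
  -- `u (k + 2) - (a / 2) v (k + 1) = (a / 2) (v (k + 1) - (b / 2) u k) + (a b / 4 - 1) u k`.
  induction k generalizing i t with
  | zero =>
    have ha : 0 ≤ -(D.A i t : ℝ) / 2 := div_nonneg (neg_A_nonneg hit) zero_le_two
    have h := add_mem hi (C.smul_mem ha ht)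
    rw [dihedralCoroot_one, dihedralCoroot_zero, dihedralCoroot_zero]
    refine ⟨hi, ?_⟩
    convert h using 1
    module
  | succ k ih =>
    obtain ⟨hu, hu'⟩ := ih hit hi ht hq
    obtain ⟨hv, hv'⟩ := ih hit.symm ht hi (by rwa [mul_comm])
    have ha : 0 ≤ -(D.A i t : ℝ) / 2 := div_nonneg (neg_A_nonneg hit) zero_le_two
    constructor
    · convert add_mem hu' (C.smul_mem ha hv) using 1
      module
    · have hab : 0 ≤ (D.A i t : ℝ) * D.A t i / 4 - 1 := by linarith
      have h := add_mem (C.smul_mem ha hv') (C.smul_mem hab hu)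
      rw [dihedralCoroot_add_two]
      convert h using 1
      module

theorem cases_of_lt_orderOfProduct {p : ℤ} (hp : 0 ≤ p) {k : ℕ}
    (hk : orderOfProduct p = 0 ∨ k < orderOfProduct p) :
    k = 0 ∨ k = 1 ∨ k = 2 ∧ 1 ≤ p ∨ k = 3 ∧ 2 ≤ p ∨ k = 4 ∧ 3 ≤ p ∨ k = 5 ∧ 3 ≤ p ∨ 4 ≤ p := by
  grind [orderOfProduct]

theorem dihedralCoroot_mem {i t : I} (hit : i ≠ t) (hi : D.coroot i ∈ C) (ht : D.coroot t ∈ C)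
    {k : ℕ} (hk : D.coxeterMatrix i t = 0 ∨ k < D.coxeterMatrix i t) :
    D.dihedralCoroot i t k ∈ C := by
  have hmem : ∀ {r s : ℝ}, 0 ≤ r → 0 ≤ s →
      r • D.coroot i + (-(D.A i t : ℝ) * s) • D.coroot t ∈ C := fun hr hs =>
    add_mem (C.smul_mem hr hi) (C.smul_mem (mul_nonneg (neg_A_nonneg hit) hs) ht)
  have hp : 0 ≤ D.A i t * D.A t i :=
    mul_nonneg_of_nonpos_of_nonpos (D.isGCM.offDiag_nonpos i t hit)
      (D.isGCM.offDiag_nonpos t i hit.symm)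
  rw [coxeterMatrix_apply_of_ne hit] at hk
  rcases cases_of_lt_orderOfProduct hp hk with
    rfl | rfl | ⟨rfl, hq⟩ | ⟨rfl, hq⟩ | ⟨rfl, hq⟩ | ⟨rfl, hq⟩ | hq
  · rwa [dihedralCoroot_zero]
  · rw [dihedralCoroot_one]
    convert hmem zero_le_one zero_le_one using 1
    module
  · rify at hq
    rw [dihedralCoroot_two rfl]
    convert hmem (sub_nonneg.2 hq) zero_le_one using 1
    module
  · rify at hq
    rw [dihedralCoroot_three rfl]
    exact hmem (by linarith) (by linarith)
  · rify at hq
    rw [dihedralCoroot_four rfl]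
    exact hmem (by nlinarith) (by linarith)
  · rify at hq
    rw [dihedralCoroot_five rfl]
    exact hmem (by nlinarith) (by nlinarith)
  · rify at hq
    exact dihedralCoroot_mem_of_four_le hit hi ht hq k

variable {x : D.Cartan}

theorem action_coroot_mem_corootCone {w : D.Weyl} {i : I}
    (hw : ¬ D.coxeterSystem.IsRightDescent w i) : D.action w (D.coroot i) ∈ D.corootCone := by
  induction hl : D.coxeterSystem.length w using Nat.strong_induction_on generalizing w i with
  | _ l ih =>
  subst hl
  by_cases hw1 : w = 1
  · simpa [hw1] using coroot_mem_corootCone i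
  obtain ⟨t, ht⟩ := D.coxeterSystem.exists_rightDescent_of_ne_one hw1
  have hit : i ≠ t := fun hit => hw (hit ▸ ht)
  obtain ⟨v, k, hwv, hlen, hvi, hvt, hk⟩ :=
    exists_eq_mul_wordProd_alternatingWord D.coxeterSystem hw t
  have hk0 : k ≠ 0 := by
    rintro rfl
    exact hvt (by simpa [hwv, alternatingWord] using ht)
  have hvw : D.coxeterSystem.length v < D.coxeterSystem.length w := by lia
  rw [hwv, action_mul_apply]
  exact dihedralCoroot_mem (C := D.corootCone.comap (D.action v : D.Cartan →ₗ[ℝ] D.Cartan))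
    hit (ih _ hvw hvi rfl) (ih _ hvw hvt rfl) hk

theorem sub_action_mem_corootCone (hx : x ∈ D.openChamber) (w : D.Weyl) :
    x - D.action w x ∈ D.corootCone := by
  induction w using induction_on_not_isRightDescent D.coxeterSystem with
  | one => simp
  | mul_simple w i hi ih =>
    rw [sub_action_mul_simple]
    exact add_mem ih (PointedCone.smul_mem _ (hx i).le (action_coroot_mem_corootCone hi))

theorem simple_mem_standardSubgroup {J : Finset I} {j : I} (hj : j ∈ J) :
    D.coxeterSystem.simple j ∈ D.standardSubgroup J := by
  rw [CoxeterMatrix.toCoxeterSystem_simple]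
  exact Subgroup.subset_closure ⟨j, hj, rfl⟩

theorem sub_action_mem_corootSpan {J : Finset I} {w : D.Weyl} (hw : w ∈ D.standardSubgroup J)
    (v : D.Cartan) : v - D.action w v ∈ D.corootSpan J := by
  induction hw using Subgroup.closure_induction generalizing v with
  | mem w hw =>
    obtain ⟨j, hj, rfl⟩ := hw
    rw [action_simple, simpleReflection_apply, sub_sub_cancel]
    exact Submodule.smul_mem _ _ (coroot_mem_corootSpan hj)
  | one => simp
  | mul u w _ _ hu hw =>
    rw [action_mul_apply, ← sub_add_sub_cancel v (D.action w v)]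
    exact add_mem (hw v) (hu _)
  | inv w _ hw =>
    have h := neg_mem (hw (D.action w⁻¹ v))
    rwa [← action_mul_apply, mul_inv_cancel, map_one, LinearEquiv.coe_one, id, neg_sub] at h

theorem mem_standardSubgroup_iff (hcofree : D.IsCofree) (hx : x ∈ D.openChamber) {J : Finset I}
    {w : D.Weyl} : w ∈ D.standardSubgroup J ↔ x - D.action w x ∈ D.corootSpan J := by
  refine ⟨fun hw => sub_action_mem_corootSpan hw x, fun h => ?_⟩
  have hface := isFaceOf_hull_range_inf_span_image (linearIndependent_coroot hcofree) (J : Set I)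
  induction w using induction_on_not_isRightDescent D.coxeterSystem with
  | one => exact one_mem _
  | mul_simple w i hi ih =>
    have hw := sub_action_mem_corootCone hx w
    have hwi := action_coroot_mem_corootCone hi
    have hsum : D.root i x • D.action w (D.coroot i) + (x - D.action w x) ∈
        PointedCone.hull ℝ (Set.range D.coroot) ⊓ Submodule.span ℝ (D.coroot '' J) := by
      rw [add_comm, ← sub_action_mul_simple]
      exact ⟨sub_action_mem_corootCone hx _, h⟩
    have hwJ : w ∈ D.standardSubgroup J :=
      ih (hface.mem_of_add_mem_right (PointedCone.smul_mem _ (hx i).le hwi) hw hsum).2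
    have hwiJ : D.action w (D.coroot i) ∈ D.corootSpan J :=
      (hface.mem_of_smul_add_mem hwi hw (hx i) hsum).2
    have hiJ : D.coroot i ∈ D.corootSpan J := by
      simpa using add_mem (sub_action_mem_corootSpan hwJ (D.coroot i)) hwiJ
    exact mul_mem hwJ (simple_mem_standardSubgroup (mem_of_coroot_mem_corootSpan hcofree hiJ))

theorem action_mem_hull {X : Set D.Weyl} {u : D.Weyl} (hu : u ∈ X) :
    D.action u x ∈ D.hull X x :=
  subset_convexHull ℝ _ ⟨u, hu, rfl⟩

theorem self_mem_hull {H : Subgroup D.Weyl} : x ∈ D.hull H x := by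
  simpa using action_mem_hull (x := x) (one_mem H)

theorem simpleReflection_mem_hull {J : Finset I} {j : I} (hj : j ∈ J) :
    x - D.root j x • D.coroot j ∈ D.hull (D.standardSubgroup J) x := by
  rw [← action_simple_apply]
  exact action_mem_hull (simple_mem_standardSubgroup hj)

theorem hull_mono {X Y : Set D.Weyl} (h : X ⊆ Y) : D.hull X x ⊆ D.hull Y x :=
  convexHull_mono (Set.image_mono h)

theorem action_image_hull (w : D.Weyl) (X : Set D.Weyl) (x : D.Cartan) :
    D.action w '' D.hull X x = D.hull (w • X) x := by
  have h := (D.action w : D.Cartan →ₗ[ℝ] D.Cartan).image_convexHull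
    ((fun u => D.action u x) '' X)
  simp only [LinearEquiv.coe_coe] at h
  rw [hull, h, hull, ← Set.image_smul, Set.image_image, Set.image_image]
  simp only [smul_eq_mul, action_mul_apply]

theorem action_image_Xi (w : D.Weyl) (x : D.Cartan) : D.action w '' D.Xi x = D.Xi x := by
  rw [Xi, action_image_hull, Set.smul_set_univ]

theorem sub_mem_corootSpan_of_mem_hull {J : Finset I} {y : D.Cartan}
    (hy : y ∈ D.hull (D.standardSubgroup J) x) : x - y ∈ D.corootSpan J := by
  refine convexHull_min ?_ (convex_setOf_sub_mem (D.corootSpan J : PointedCone ℝ D.Cartan) x) hy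
  rintro _ ⟨u, hu, rfl⟩
  exact sub_action_mem_corootSpan hu x

theorem sub_mem_corootCone_of_mem_Xi (hx : x ∈ D.openChamber) {y : D.Cartan} (hy : y ∈ D.Xi x) :
    x - y ∈ D.corootCone := by
  refine convexHull_min ?_ (convex_setOf_sub_mem D.corootCone x) hy
  rintro _ ⟨u, -, rfl⟩
  exact sub_action_mem_corootCone hx u

theorem vectorSpan_hull_standardSubgroup (hx : x ∈ D.openChamber) (J : Finset I) :
    vectorSpan ℝ (D.hull (D.standardSubgroup J) x) = D.corootSpan J := by
  refine le_antisymm ?_ ?_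
  · rw [vectorSpan_def, Submodule.span_le]
    rintro _ ⟨p, hp, q, hq, rfl⟩
    simpa using sub_mem (sub_mem_corootSpan_of_mem_hull hq) (sub_mem_corootSpan_of_mem_hull hp)
  · rw [corootSpan, Submodule.span_le]
    rintro _ ⟨j, hj, rfl⟩
    have h := vsub_mem_vectorSpan ℝ self_mem_hull (simpleReflection_mem_hull (x := x) hj)
    rw [vsub_eq_sub, sub_sub_cancel] at h
    exact (Submodule.smul_mem_iff _ (hx j).ne').1 h

theorem affineDim_hull (hcofree : D.IsCofree) (hx : x ∈ D.openChamber) (w : D.Weyl)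
    (J : Finset I) :
    affineDim (D.hull (w • (D.standardSubgroup J : Set D.Weyl)) x) = J.card := by
  rw [← action_image_hull, affineDim_image, affineDim, direction_affineSpan,
    vectorSpan_hull_standardSubgroup hx, finrank_corootSpan hcofree]

theorem eq_hull_of_action_mem_iff {F : Set D.Cartan} (hF : IsConvexFace (D.Xi x) F)
    {X : Set D.Weyl} (hX : ∀ u, D.action u x ∈ F ↔ u ∈ X) : F = D.hull X x := by
  have hinter : (fun u => D.action u x) '' Set.univ ∩ F = (fun u => D.action u x) '' X := by
    ext y
    constructor
    · rintro ⟨⟨u, -, rfl⟩, hu⟩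
      exact ⟨u, (hX u).1 hu, rfl⟩
    · rintro ⟨u, hu, rfl⟩
      exact ⟨⟨u, trivial, rfl⟩, (hX u).2 hu⟩
  rw [← hF.convexHull_inter, hinter, hull]

theorem isConvexFace_hull_standardSubgroup (hcofree : D.IsCofree) (hx : x ∈ D.openChamber)
    (J : Finset I) : IsConvexFace (D.Xi x) (D.hull (D.standardSubgroup J) x) := by
  let G : PointedCone ℝ D.Cartan := D.corootCone ⊓ D.corootSpan J
  have hG : IsConvexFace (D.Xi x) {y ∈ D.Xi x | x - y ∈ G} :=
    { nonempty := ⟨x, self_mem_hull (H := ⊤), by simp⟩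
      convex := (convex_convexHull ℝ _).inter (convex_setOf_sub_mem G x)
      isExtreme := isExtreme_sep_sub_mem
        (isFaceOf_hull_range_inf_span_image (linearIndependent_coroot hcofree) (J : Set I))
        fun _ => sub_mem_corootCone_of_mem_Xi hx }
  rwa [eq_hull_of_action_mem_iff hG fun u => ?_] at hG
  rw [SetLike.mem_coe, mem_standardSubgroup_iff hcofree hx]
  exact ⟨fun h => h.2.2, fun h => ⟨action_mem_hull trivial, sub_action_mem_corootCone hx u, h⟩⟩

theorem isConvexFace_hull (hcofree : D.IsCofree) (hx : x ∈ D.openChamber)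
    (X : D.StandardCosets) : IsConvexFace (D.Xi x) (D.hull X x) := by
  obtain ⟨_, w, J, rfl⟩ := X
  rw [← action_image_hull, ← action_image_Xi w]
  exact (isConvexFace_hull_standardSubgroup hcofree hx J).image (D.action w)

theorem action_mem_hull_iff (hcofree : D.IsCofree) (hx : x ∈ D.openChamber)
    (X : D.StandardCosets) {u : D.Weyl} : D.action u x ∈ D.hull X x ↔ u ∈ (X : Set D.Weyl) := by
  refine ⟨fun hu => ?_, action_mem_hull⟩
  obtain ⟨_, w, J, rfl⟩ := X
  obtain ⟨y, hy, hyu⟩ := (action_image_hull w _ x).symm.subset hu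
  obtain rfl : y = D.action (w⁻¹ * u) x := by
    rw [action_mul_apply, ← hyu, ← action_mul_apply, inv_mul_cancel, map_one]
    rfl
  rw [Set.mem_smul_set_iff_inv_smul_mem]
  exact (mem_standardSubgroup_iff hcofree hx).2 (sub_mem_corootSpan_of_mem_hull hy)

theorem hull_subset_hull_iff (hcofree : D.IsCofree) (hx : x ∈ D.openChamber)
    {X Y : D.StandardCosets} : D.hull X x ⊆ D.hull Y x ↔ X ≤ Y :=
  ⟨fun h _ hu => (action_mem_hull_iff hcofree hx Y).1 (h (action_mem_hull hu)), hull_mono⟩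

theorem exists_eq_hull_standardSubgroup (hcofree : D.IsCofree) (hx : x ∈ D.openChamber)
    {F : Set D.Cartan} (hF : IsConvexFace (D.Xi x) F) (hxF : x ∈ F) :
    ∃ J : Finset I, F = D.hull (D.standardSubgroup J) x := by
  have : Finite I := hcofree.finite_of_isNoetherian
  let z (i : I) : D.Cartan := x - D.root i x • D.coroot i
  let J : Finset I := (Set.toFinite {i | z i ∈ F}).toFinset
  refine ⟨J, eq_hull_of_action_mem_iff hF fun u => ?_⟩
  obtain ⟨c, hc, hcu⟩ :=
    mem_hull_range_iff_exists_linearCombination.1 (sub_action_mem_corootCone hx u)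
  have hz : ∀ i, z i ∈ D.Xi x := fun i =>
    hull_mono (Set.subset_univ _) (simpleReflection_mem_hull (Finset.mem_singleton_self i))
  have hpos : ∀ i ∈ c.support, 0 < c i / D.root i x := fun i hi =>
    div_pos ((hc i).lt_of_ne' (Finsupp.mem_support_iff.1 hi)) (hx i)
  have hux : D.action u x - x = ∑ i ∈ c.support, (c i / D.root i x) • (z i - x) := by
    rw [← neg_sub, ← hcu, Finsupp.linearCombination_apply, Finsupp.sum, ← Finset.sum_neg_distrib]
    refine Finset.sum_congr rfl fun i _ => ?_
    rw [sub_sub_cancel_left, smul_neg, smul_smul, div_mul_cancel₀ _ (hx i).ne']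
  rw [hF.mem_iff_of_sub_eq_sum (convex_convexHull ℝ _) hxF (action_mem_hull trivial) hpos
    (fun i _ => hz i) hux, SetLike.mem_coe, mem_standardSubgroup_iff hcofree hx, ← hcu, corootSpan,
    linearCombination_mem_span_image_iff (linearIndependent_coroot hcofree), Finset.coe_subset]
  simp only [Finset.subset_iff, J, Set.Finite.mem_toFinset, Set.mem_ofPred_eq]

theorem exists_eq_hull (hcofree : D.IsCofree) (hx : x ∈ D.openChamber) {F : Set D.Cartan}
    (hF : IsConvexFace (D.Xi x) F) : ∃ X : D.StandardCosets, F = D.hull X x := by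
  obtain ⟨_, ⟨w, -, rfl⟩, hw⟩ := convexHull_nonempty_iff.1
    (hF.convexHull_inter.symm ▸ hF.nonempty)
  have hF' := hF.image (D.action w⁻¹)
  rw [action_image_Xi] at hF'
  obtain ⟨J, hJ⟩ := exists_eq_hull_standardSubgroup hcofree hx hF' ⟨_, hw, by simp⟩
  refine ⟨⟨_, w, J, rfl⟩, ?_⟩
  rw [← action_image_hull, ← hJ, Set.image_image]
  simp

/-- The isomorphism `X ↦ conv(X · x)` from the poset of standard cosets onto the face poset
of `Ξ_x`. -/
noncomputable def standardCosetsOrderIso (hcofree : D.IsCofree) (hx : x ∈ D.openChamber) :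
    D.StandardCosets ≃o FacePoset (D.Xi x) :=
  RelIso.ofSurjective
    (OrderEmbedding.ofMapLEIff (fun X => ⟨D.hull X x, isConvexFace_hull hcofree hx X⟩)
      fun _ _ => hull_subset_hull_iff hcofree hx)
    fun F => (exists_eq_hull hcofree hx F.2).imp fun _ hX => Subtype.ext hX.symm

end KacMoodyRootDatum

theorem mainTheorem4_general {I Λ : Type*} [DecidableEq I] [AddCommGroup Λ] [Module.Free ℤ Λ]
    [Module.Finite ℤ Λ] (D : KacMoodyRootDatum I Λ) (hcofree : D.IsCofree)
    (x : D.Cartan) (hx : x ∈ D.openChamber) :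
    (∀ (w : D.Weyl) (J : Finset I),
      D.action w '' D.hull (D.standardSubgroup J) x
          = D.hull (w • (D.standardSubgroup J : Set D.Weyl)) x ∧
        IsConvexFace (D.Xi x) (D.hull (w • (D.standardSubgroup J : Set D.Weyl)) x) ∧
        affineDim (D.hull (w • (D.standardSubgroup J : Set D.Weyl)) x) = J.card) ∧
    (∀ F : Set D.Cartan, IsConvexFace (D.Xi x) F →
      ∃! X : D.StandardCosets, F = D.hull X x) ∧
    (∃ e : D.StandardCosets ≃o FacePoset (D.Xi x),
      ∀ X : D.StandardCosets, (e X : Set D.Cartan) = D.hull X x) := by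
  open KacMoodyRootDatum in
  refine ⟨fun w J => ⟨action_image_hull w _ x, isConvexFace_hull hcofree hx ⟨_, w, J, rfl⟩,
    affineDim_hull hcofree hx w J⟩, fun F hF => ?_, standardCosetsOrderIso hcofree hx, fun _ => rfl⟩
  obtain ⟨X, hX, huniq⟩ := (standardCosetsOrderIso hcofree hx).bijective.existsUnique ⟨F, hF⟩
  exact ⟨X, congrArg Subtype.val hX.symm, fun Y hY => huniq Y (Subtype.ext hY.symm)⟩

theorem mainTheorem4 {I Λ : Type*} [Fintype I] [DecidableEq I]
    [AddCommGroup Λ] [Module.Free ℤ Λ] [Module.Finite ℤ Λ]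
    (D : KacMoodyRootDatum I Λ) (hsymm : IsSymmetrizable D.A)
    (hfree : D.IsFree) (hcofree : D.IsCofree)
    (x : D.Cartan) (hx : x ∈ D.openChamber) :
    (∀ (w : D.Weyl) (J : Finset I),
      D.action w '' D.hull (D.standardSubgroup J) x
          = D.hull (w • (D.standardSubgroup J : Set D.Weyl)) x ∧
        IsConvexFace (D.Xi x) (D.hull (w • (D.standardSubgroup J : Set D.Weyl)) x) ∧
        affineDim (D.hull (w • (D.standardSubgroup J : Set D.Weyl)) x) = J.card) ∧
    (∀ F : Set D.Cartan, IsConvexFace (D.Xi x) F →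
      ∃! X : D.StandardCosets, F = D.hull X x) ∧
    (∃ e : D.StandardCosets ≃o FacePoset (D.Xi x),
      ∀ X : D.StandardCosets, (e X : Set D.Cartan) = D.hull X x) :=
  mainTheorem4_general D hcofree x hx
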